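/- Let $X$ be a real Banach space and let $A\subset X\times X$ be (the graph of) a possibly multivalued nonlinear $m$-accretive operator, i.e. $\|(x-\hat x)+\lambda(y-\hat y)\|\ge\|x-\hat x\|$ for all $(x,y),(\hat x,\hat y)\in A$ and $\lambda\ge 0$, and $\operatorname{Range}(I+A)=X$. Assume $\overline{D(A)}=X$, and let $$S(t)x=\lim_{n\to\infty}\Big(I+\frac tn A\Big)^{-n}x,\qquad t\ge 0,\ x\in X,$$ be the nonlinear semigroup generated by $A$ (with $S(0)x=x$). Let $0<T<\infty$ and let $F:[0,T]\times X\to X$ be such that $F(\cdot,x)$ is Bochner integrable on $[0,T]$ for each $x\in X$. Assume a1) there is a function $K(t,U)\ge 0$, $t\in[0,T]$, $U\ge 0$, such that $K(\cdot,U)$ is locally integrable on $[0,T]$ for each $U\ge0$, $K(t,\cdot)$ is continuous and nondecreasing on $[0,\infty)$ for a.e. $t\in(0,T)$, $K(t,0)=0$ for all $t\in[0,T]$, and $$\|F(t,x)-F(t,y)\|\le K(t,\|x-y\|)\quad\text{for a.e. }t\in(0,T)\text{ and all }x,y\in X.$$ For $w\in C([0,T];X)$ and $t\in[0,T]$ put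 $\|w\|_{\mathbb B_t}=\sup_{0\le s\le t}\|w(s)\|$, and equip $C([0,T];X)$ with the norm $\|\cdot\|_{\mathbb B_T}$. For $u_0\in X$ and $u\in C([0,T];X)$ define $$\mathcal G^{u_0}u(t)=S(t)u_0+\int_0^tS(t-s)F(s,u(s))\,ds,\qquad 0\le t\le T.$$ Then $\mathcal G^{u_0}$ is a well-defined map from $C([0,T];X)$ into itself: the limit defining $S(t)x$ exists for all $t\ge0$ and $x\in X$; for each $u\in C([0,T];X)$ and $t\in[0,T]$ the function $s\mapsto S(t-s)F(s,u(s))$ is Bochner integrable on $(0,t)$; and $\mathcal G^{u_0}u\in C([0,T];X)$. Moreover, for all $u_0,\hat u_0\in X$, all $u,v\in C([0,T];X)$ and all $t\in[0,T]$, the function $s\mapsto K(s,\|u-v\|_{\mathbb B_s})$ is integrable on $(0,t)$ and $$\|\mathcal G^{u_0}u-\mathcal G^{\hat u_0}v\|_{\mathbb B_t}\le\|u_0-\hat u_0\|+\int_0^tK\big(s,\|u-v\|_{\mathbb B_s}\big)\,ds .$$ Finally, for each $u_0\in X$ the operator $\mathcal G^{u_0}:C([0,T];X)\to C([0,T];X)$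 is continuous. -/

import Mathlib

open MeasureTheory Filter Topology

noncomputable section

namespace MildEvolution

variable {X : Type*} [NormedAddCommGroup X] [NormedSpace ℝ X]

/-- A possibly multivalued nonlinear operator on `X`, given by its graph `A ⊆ X × X`
(`(x, y) ∈ A` means `y ∈ A x`), is m-accretive if it is accretive and `I + A` is onto. -/
structure IsMAccretive (A : Set (X × X)) : Prop where
  accretive : ∀ p ∈ A, ∀ q ∈ A, ∀ r : ℝ, 0 ≤ r →
    ‖p.1 - q.1‖ ≤ ‖(p.1 - q.1) + r • (p.2 - q.2)‖
  range_eq : ∀ x : X, ∃ p ∈ A, p.1 + p.2 = x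

/-- The domain of the operator with graph `A`. -/
def domain (A : Set (X × X)) : Set X := Prod.fst '' A

open Classical in
/-- The resolvent `J_r = (I + r A)⁻¹`: the point `z` with `x ∈ z + r A z`.
For m-accretive `A` and `r > 0` such a `z` exists and is unique, so the second branch is void;
for `r = 0` both branches give `J_0 x = x`. -/
def resolventMap (A : Set (X × X)) (r : ℝ) (x : X) : X :=
  if h : ∃ p ∈ A, p.1 + r • p.2 = x then h.choose.1 else x

/-- The `n`-th implicit Euler approximation `(I + (t/n) A)⁻ⁿ x` of the semigroup. -/
def eulerApprox (A : Set (X × X)) (t : ℝ) (x : X) (n : ℕ) : X :=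
  (resolventMap A (t / n))^[n] x

/-- The nonlinear semigroup generated by `-A`, through the exponential formula
`S(t) x = lim_n (I + (t/n) A)⁻ⁿ x`. -/
def semigroup (A : Set (X × X)) (t : ℝ) (x : X) : X :=
  limUnder atTop (eulerApprox A t x)

/-- The right-hand side of the variation of constants formula,
`S(t) u₀ + ∫₀ᵗ S(t - s) F(s, u(s)) ds`. -/
def duhamel (A : Set (X × X)) (F : ℝ → X → X) (u₀ : X) (u : ℝ → X) (t : ℝ) : X :=
  semigroup A t u₀ + ∫ s in (0 : ℝ)..t, semigroup A (t - s) (F s (u s))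

/-- The norm of `C([0,t]; X)`, `sup_{0 ≤ s ≤ t} ‖w(s)‖`, of a function `w ∈ C([0,T]; X)`,
for `t ∈ [0,T]`. -/
def normUpTo {T : ℝ} (t : ℝ) (w : C(Set.Icc (0 : ℝ) T, X)) : ℝ :=
  ⨆ s : {s : Set.Icc (0 : ℝ) T // (s : ℝ) ≤ t}, ‖w s.1‖

/-- The structural condition on `F : [0,T] × X → X` with modulus `K : [0,T] × [0,∞) → [0,∞)`. -/
structure StructuralCondition (T : ℝ) (F : ℝ → X → X) (K : ℝ → ℝ → ℝ) : Prop where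
  nonneg : ∀ t ∈ Set.Icc 0 T, ∀ U : ℝ, 0 ≤ U → 0 ≤ K t U
  locallyIntegrable : ∀ U : ℝ, 0 ≤ U → LocallyIntegrableOn (fun t => K t U) (Set.Icc 0 T)
  continuousOn : ∀ᵐ t ∂(volume.restrict (Set.Ioo 0 T)), ContinuousOn (K t) (Set.Ici 0)
  monotoneOn : ∀ᵐ t ∂(volume.restrict (Set.Ioo 0 T)), MonotoneOn (K t) (Set.Ici 0)
  zero : ∀ t ∈ Set.Icc 0 T, K t 0 = 0
  bound : ∀ᵐ t ∂(volume.restrict (Set.Ioo 0 T)), ∀ x y : X, ‖F t x - F t y‖ ≤ K t ‖x - y‖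

end MildEvolution

end

open MeasureTheory Filter Topology

namespace MildEvolution

/-! ### Resolvents, the Crandall–Liggett estimate and the semigroup -/

section Semigroup

variable {X : Type*} [NormedAddCommGroup X] [NormedSpace ℝ X] {A : Set (X × X)}

/-! The semigroup comes from the Crandall–Liggett theorem. Accretivity compares Euler iterates with
two step sizes, and a double induction bounds their distance from a common starting point in the
domain (`norm_iterate_sub_iterate_le_sqrt`). Hence the approximations are Cauchy and `S(t)x` is
Lipschitz in `t` for `x` in the domain. Since every `S(t)` is nonexpansive, density gives
convergence for all `x` and joint continuity of `(t, x) ↦ S(t)x`.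

The modulus `K` makes `F(s, ·)` continuous for a.e. `s`, so `s ↦ F(s, u(s))` is measurable, and
`‖F(s, 0)‖ + K(s, ‖u(s)‖)` dominates it. Convolving with a jointly continuous nonexpansive family
preserves integrability and gives a continuous function of `t` (`continuous_integral_comp_sub`). The
estimate follows by applying nonexpansiveness under the integral, and continuity of the operator
because `∫ K(s, U) ds → 0` as `U → 0`. -/

theorem resolventMap_spec {r : ℝ} {x : X} (h : ∃ p ∈ A, p.1 + r • p.2 = x) :
    ∃ y, (resolventMap A r x, y) ∈ A ∧ resolventMap A r x + r • y = x := by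
  unfold resolventMap
  rw [dif_pos h]
  exact ⟨h.choose.2, h.choose_spec.1, h.choose_spec.2⟩

theorem resolventMap_zero (A : Set (X × X)) (x : X) : resolventMap A 0 x = x := by
  by_cases h : ∃ p ∈ A, p.1 + (0 : ℝ) • p.2 = x
  · obtain ⟨y, -, hy⟩ := resolventMap_spec h
    simpa using hy
  · exact dif_neg h

theorem iterate_resolventMap_zero (A : Set (X × X)) (n : ℕ) (x : X) :
    (resolventMap A 0)^[n] x = x :=
  Function.iterate_fixed (resolventMap_zero A x) n

/-- Solving with step `m` amounts to the fixed-point equation `z = J_l((l/m) x + (1 - l/m) z)`. As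
`J_l` is nonexpansive, this is a contraction when `|1 - l/m| < 1`, that is `m > l/2`. -/
theorem IsMAccretive.exists_add_smul_eq_of_half_lt [CompleteSpace X] (hA : IsMAccretive A)
    {l m : ℝ} (hl : 0 < l) (hlm : l / 2 < m)
    (hs : ∀ x : X, ∃ p ∈ A, p.1 + l • p.2 = x) (x : X) : ∃ p ∈ A, p.1 + m • p.2 = x := by
  have hm : 0 < m := by linarith
  choose J hJ hJx using hs
  have hlip : ∀ a b, ‖(J a).1 - (J b).1‖ ≤ ‖a - b‖ := fun a b => by
    refine (hA.accretive _ (hJ a) _ (hJ b) l hl.le).trans_eq ?_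
    conv_rhs => rw [← hJx a, ← hJx b]
    congr 1
    rw [smul_sub]
    abel
  set c : ℝ := 1 - l / m
  have hc : |c| < 1 := by
    have h1 : 0 < l / m := by positivity
    have h2 : l / m < 2 := by rw [div_lt_iff₀ hm]; linarith
    exact abs_lt.2 ⟨by simp only [c]; linarith, by simp only [c]; linarith⟩
  let f : X → X := fun z => (J ((l / m) • x + c • z)).1
  have hf : ContractingWith ⟨|c|, abs_nonneg c⟩ f := by
    refine ⟨by exact_mod_cast hc, LipschitzWith.of_dist_le_mul fun a b => ?_⟩
    rw [dist_eq_norm, dist_eq_norm]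
    refine (hlip _ _).trans_eq ?_
    rw [add_sub_add_left_eq_sub, ← smul_sub, norm_smul]
    rfl
  have hz : f hf.fixedPoint = hf.fixedPoint := hf.fixedPoint_isFixedPt
  set z := hf.fixedPoint
  refine ⟨J ((l / m) • x + c • z), hJ _, ?_⟩
  have h := hJx ((l / m) • x + c • z)
  change (J _).1 = z at hz
  rw [hz] at h ⊢
  have h2 : l • (J ((l / m) • x + c • z)).2 = (l / m) • (x - z) := by
    rw [eq_sub_of_add_eq' h]
    simp only [c]
    module
  have h3 : m • (J ((l / m) • x + c • z)).2 = x - z := by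
    have := congrArg (fun w => (m / l) • w) h2
    simp only [smul_smul] at this
    rwa [div_mul_cancel₀ _ hl.ne', div_mul_div_cancel₀ hl.ne', div_self hm.ne', one_smul] at this
  rw [h3]
  abel

theorem IsMAccretive.exists_add_smul_eq [CompleteSpace X] (hA : IsMAccretive A)
    {r : ℝ} (hr : 0 < r) (x : X) : ∃ p ∈ A, p.1 + r • p.2 = x := by
  -- Any ratio in `(1/2, 1)` would do: surjectivity passes from step `1` down to arbitrarily small
  -- steps, and from a step below `r` up to `r` at once.
  have key : ∀ n : ℕ, ∀ x : X, ∃ p ∈ A, p.1 + ((3 / 4 : ℝ) ^ n) • p.2 = x := by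
    intro n
    induction n with
    | zero => simpa using hA.range_eq
    | succ n ih =>
      have : 0 < (3 / 4 : ℝ) ^ n := by positivity
      exact hA.exists_add_smul_eq_of_half_lt this (by rw [pow_succ]; linarith) ih
  obtain ⟨n, hn⟩ := exists_pow_lt_of_lt_one hr (by norm_num : (3 / 4 : ℝ) < 1)
  have : 0 < (3 / 4 : ℝ) ^ n := by positivity
  exact hA.exists_add_smul_eq_of_half_lt this (by linarith) (key n) x

variable [CompleteSpace X]

theorem IsMAccretive.resolventMap_spec (hA : IsMAccretive A) {r : ℝ} (hr : 0 < r) (x : X) :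
    ∃ y, (resolventMap A r x, y) ∈ A ∧ resolventMap A r x + r • y = x :=
  MildEvolution.resolventMap_spec (hA.exists_add_smul_eq hr x)

theorem IsMAccretive.norm_resolventMap_sub_le (hA : IsMAccretive A) {r : ℝ} (hr : 0 ≤ r)
    (x y : X) : ‖resolventMap A r x - resolventMap A r y‖ ≤ ‖x - y‖ := by
  rcases hr.eq_or_lt with rfl | hr
  · simp [resolventMap_zero]
  obtain ⟨a, ha, hax⟩ := hA.resolventMap_spec hr x
  obtain ⟨b, hb, hby⟩ := hA.resolventMap_spec hr y
  refine (hA.accretive _ ha _ hb r hr.le).trans_eq ?_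
  conv_rhs => rw [← hax, ← hby]
  congr 1
  rw [smul_sub]
  abel

theorem IsMAccretive.norm_resolventMap_sub_self_le (hA : IsMAccretive A) {r : ℝ} (hr : 0 ≤ r)
    {x y : X} (hx : (x, y) ∈ A) : ‖resolventMap A r x - x‖ ≤ r * ‖y‖ := by
  rcases hr.eq_or_lt with rfl | hr
  · simp [resolventMap_zero]
  obtain ⟨a, ha, hax⟩ := hA.resolventMap_spec hr x
  refine (hA.accretive _ ha _ hx r hr.le).trans_eq ?_
  have : resolventMap A r x - x + r • (a - y) = -(r • y) := by
    rw [smul_sub]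
    nth_rewrite 2 [← hax]
    abel
  simp only [this, norm_neg, norm_smul, Real.norm_of_nonneg hr.le]

theorem IsMAccretive.norm_iterate_sub_iterate_le (hA : IsMAccretive A) {r : ℝ} (hr : 0 ≤ r)
    (n : ℕ) (x y : X) : ‖(resolventMap A r)^[n] x - (resolventMap A r)^[n] y‖ ≤ ‖x - y‖ := by
  induction n with
  | zero => simp
  | succ n ih =>
    rw [Function.iterate_succ_apply', Function.iterate_succ_apply']
    exact (hA.norm_resolventMap_sub_le hr _ _).trans ih

theorem IsMAccretive.norm_iterate_sub_self_le (hA : IsMAccretive A) {r : ℝ} (hr : 0 ≤ r)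
    (n : ℕ) {x y : X} (hx : (x, y) ∈ A) : ‖(resolventMap A r)^[n] x - x‖ ≤ n * r * ‖y‖ := by
  induction n with
  | zero => simp
  | succ n ih =>
    rw [Function.iterate_succ_apply]
    have h1 := hA.norm_iterate_sub_iterate_le hr n (resolventMap A r x) x
    have h2 := hA.norm_resolventMap_sub_self_le hr hx
    have h3 := norm_sub_le_norm_sub_add_norm_sub
      ((resolventMap A r)^[n] (resolventMap A r x)) ((resolventMap A r)^[n] x) x
    push_cast
    linarith

/-- The two-parameter recursive inequality for resolvents with different step sizes. -/
theorem IsMAccretive.norm_resolventMap_sub_resolventMap_le (hA : IsMAccretive A) {l m : ℝ}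
    (hl : 0 < l) (hm : 0 < m) (x y : X) :
    ‖resolventMap A l x - resolventMap A m y‖ ≤
      m / (l + m) * ‖x - resolventMap A m y‖ + l / (l + m) * ‖resolventMap A l x - y‖ := by
  obtain ⟨a, ha, hax⟩ := hA.resolventMap_spec hl x
  obtain ⟨b, hb, hby⟩ := hA.resolventMap_spec hm y
  -- With this parameter, substituting `l • a = x - u` and `m • b = y - v` turns the right-hand side
  -- into a convex combination of `x - v` and `u - y`.
  have h := hA.accretive _ ha _ hb (l * m / (l + m)) (by positivity)
  simp only at h
  set u := resolventMap A l x
  set v := resolventMap A m y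
  have hlm : l + m ≠ 0 := by positivity
  have e : u - v + (l * m / (l + m)) • (a - b) =
      (m / (l + m)) • (x - v) + (l / (l + m)) • (u - y) := by
    have : (1 : ℝ) • (u - v) = (m / (l + m) + l / (l + m)) • (u - v) := by
      rw [← add_div, add_comm m l, div_self hlm]
    rw [one_smul] at this
    rw [this, ← hax, ← hby]
    module
  rw [e] at h
  refine h.trans ((norm_add_le _ _).trans_eq ?_)
  rw [norm_smul, norm_smul, Real.norm_of_nonneg (by positivity), Real.norm_of_nonneg (by positivity)]

theorem convex_combination_sqrt_le {a b p q : ℝ} (ha : 0 ≤ a) (hb : 0 ≤ b) (hab : a + b = 1)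
    (hp : 0 ≤ p) (hq : 0 ≤ q) : a * √p + b * √q ≤ √(a * p + b * q) :=
  (Real.strictConcaveOn_sqrt.concaveOn).2 hp hq ha hb hab

theorem IsMAccretive.norm_iterate_sub_iterate_le_sqrt_of_pos (hA : IsMAccretive A) {l m : ℝ}
    (hl : 0 < l) (hm : 0 < m) {x y : X} (hx : (x, y) ∈ A) (i j : ℕ) :
    ‖(resolventMap A l)^[i] x - (resolventMap A m)^[j] x‖ ≤
      √((i * l - j * m) ^ 2 + i * l ^ 2 + j * m ^ 2) * ‖y‖ := by
  induction i generalizing j with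
  | zero =>
    rw [Function.iterate_zero_apply, norm_sub_rev]
    refine (hA.norm_iterate_sub_self_le hm.le j hx).trans ?_
    gcongr
    apply Real.le_sqrt_of_sq_le
    have : 0 ≤ j * m ^ 2 := by positivity
    push_cast
    nlinarith
  | succ i ih =>
    induction j with
    | zero =>
      rw [Function.iterate_zero_apply]
      refine (hA.norm_iterate_sub_self_le hl.le (i + 1) hx).trans ?_
      gcongr
      apply Real.le_sqrt_of_sq_le
      have : 0 ≤ ((i + 1 : ℕ) : ℝ) * l ^ 2 := by positivity
      push_cast at *
      nlinarith
    | succ j ihj =>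
      have h1 := ih (j + 1)
      rw [Function.iterate_succ_apply'] at h1 ihj ⊢
      rw [Function.iterate_succ_apply'] at ⊢
      refine (hA.norm_resolventMap_sub_resolventMap_le hl hm _ _).trans ?_
      have hlm : l + m ≠ 0 := by positivity
      calc _ ≤ m / (l + m) * (√((i * l - (j + 1 : ℕ) * m) ^ 2 + i * l ^ 2 + (j + 1 : ℕ) * m ^ 2)
              * ‖y‖) + l / (l + m) * (√(((i + 1 : ℕ) * l - j * m) ^ 2 + (i + 1 : ℕ) * l ^ 2
              + j * m ^ 2) * ‖y‖) := by gcongr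
        _ = (m / (l + m) * √((i * l - (j + 1 : ℕ) * m) ^ 2 + i * l ^ 2 + (j + 1 : ℕ) * m ^ 2)
              + l / (l + m) * √(((i + 1 : ℕ) * l - j * m) ^ 2 + (i + 1 : ℕ) * l ^ 2
              + j * m ^ 2)) * ‖y‖ := by ring
        _ ≤ _ := by
          gcongr
          -- Concavity of the square root moves the average inside, where the radicand satisfies the
          -- recursion with equality: the cross terms cancel, and the excess `l * m` from the
          -- squares is absorbed by the variance terms.
          refine (convex_combination_sqrt_le (by positivity) (by positivity)
            (by rw [← add_div, add_comm m l, div_self hlm]) (by positivity)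
            (by positivity)).trans_eq ?_
          congr 1
          push_cast
          field_simp
          ring

/-- The Crandall–Liggett estimate for implicit Euler iterates with different step sizes. -/
theorem IsMAccretive.norm_iterate_sub_iterate_le_sqrt (hA : IsMAccretive A) {l m : ℝ}
    (hl : 0 ≤ l) (hm : 0 ≤ m) {x y : X} (hx : (x, y) ∈ A) (i j : ℕ) :
    ‖(resolventMap A l)^[i] x - (resolventMap A m)^[j] x‖ ≤
      √((i * l - j * m) ^ 2 + i * l ^ 2 + j * m ^ 2) * ‖y‖ := by
  rcases hl.eq_or_lt with rfl | hl
  · rw [iterate_resolventMap_zero, norm_sub_rev]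
    refine (hA.norm_iterate_sub_self_le hm j hx).trans ?_
    gcongr
    apply Real.le_sqrt_of_sq_le
    have : 0 ≤ j * m ^ 2 := by positivity
    nlinarith
  rcases hm.eq_or_lt with rfl | hm
  · rw [iterate_resolventMap_zero]
    refine (hA.norm_iterate_sub_self_le hl.le i hx).trans ?_
    gcongr
    apply Real.le_sqrt_of_sq_le
    have : 0 ≤ i * l ^ 2 := by positivity
    nlinarith
  exact hA.norm_iterate_sub_iterate_le_sqrt_of_pos hl hm hx i j

theorem IsMAccretive.norm_eulerApprox_sub_eulerApprox_le (hA : IsMAccretive A) {t : ℝ}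
    (ht : 0 ≤ t) (x y : X) (n : ℕ) : ‖eulerApprox A t x n - eulerApprox A t y n‖ ≤ ‖x - y‖ :=
  hA.norm_iterate_sub_iterate_le (by positivity) n x y

theorem IsMAccretive.norm_eulerApprox_sub_eulerApprox_le_sqrt (hA : IsMAccretive A) {t s : ℝ}
    (ht : 0 ≤ t) (hs : 0 ≤ s) {x y : X} (hx : (x, y) ∈ A) {n k : ℕ} (hn : n ≠ 0) (hk : k ≠ 0) :
    ‖eulerApprox A t x n - eulerApprox A s x k‖ ≤
      √((t - s) ^ 2 + t ^ 2 / n + s ^ 2 / k) * ‖y‖ := by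
  refine (hA.norm_iterate_sub_iterate_le_sqrt (by positivity) (by positivity) hx n k).trans_eq ?_
  congr 2
  field_simp

theorem IsMAccretive.cauchySeq_eulerApprox_of_mem (hA : IsMAccretive A) {t : ℝ} (ht : 0 ≤ t)
    {x y : X} (hx : (x, y) ∈ A) : CauchySeq (eulerApprox A t x) := by
  rw [Metric.cauchySeq_iff']
  intro e he
  have hlim : Tendsto (fun n : ℕ => √(t ^ 2 / n + t ^ 2 / n) * ‖y‖) atTop (𝓝 0) := by
    have h := tendsto_const_div_atTop_nhds_zero_nat (t ^ 2)
    have h2 := (h.add h).sqrt.mul_const ‖y‖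
    simpa using h2
  obtain ⟨N, hN, hN0⟩ := ((hlim.eventually_lt_const he).and (eventually_gt_atTop 0)).exists
  refine ⟨N, fun n hn => ?_⟩
  rw [dist_eq_norm]
  refine lt_of_le_of_lt ((hA.norm_eulerApprox_sub_eulerApprox_le_sqrt ht ht hx
    (by lia) (by lia)).trans ?_) hN
  gcongr
  simp
  gcongr

theorem IsMAccretive.cauchySeq_eulerApprox (hA : IsMAccretive A) (hd : Dense (domain A)) {t : ℝ}
    (ht : 0 ≤ t) (x : X) : CauchySeq (eulerApprox A t x) := by
  rw [Metric.cauchySeq_iff']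
  intro e he
  obtain ⟨_, hxz, ⟨z, y⟩, hz, rfl⟩ := Metric.dense_iff.1 hd x (e / 3) (by positivity)
  obtain ⟨N, hN⟩ := Metric.cauchySeq_iff'.1 (hA.cauchySeq_eulerApprox_of_mem ht hz) (e / 3)
    (by positivity)
  refine ⟨N, fun n hn => ?_⟩
  have h1 := hA.norm_eulerApprox_sub_eulerApprox_le ht x z n
  have h2 := hA.norm_eulerApprox_sub_eulerApprox_le ht z x N
  have h3 := hN n hn
  rw [← dist_eq_norm, ← dist_eq_norm] at h1 h2
  rw [Metric.mem_ball] at hxz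
  simp only at hxz
  rw [dist_comm x z] at h1
  have h4 := dist_triangle4 (eulerApprox A t x n) (eulerApprox A t z n) (eulerApprox A t z N)
    (eulerApprox A t x N)
  linarith

theorem IsMAccretive.tendsto_eulerApprox (hA : IsMAccretive A) (hd : Dense (domain A)) {t : ℝ}
    (ht : 0 ≤ t) (x : X) : Tendsto (eulerApprox A t x) atTop (𝓝 (semigroup A t x)) :=
  (hA.cauchySeq_eulerApprox hd ht x).tendsto_limUnder

theorem IsMAccretive.norm_semigroup_sub_semigroup_le (hA : IsMAccretive A)
    (hd : Dense (domain A)) {t : ℝ} (ht : 0 ≤ t) (x y : X) :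
    ‖semigroup A t x - semigroup A t y‖ ≤ ‖x - y‖ :=
  le_of_tendsto ((hA.tendsto_eulerApprox hd ht x).sub (hA.tendsto_eulerApprox hd ht y)).norm
    (Eventually.of_forall fun n => hA.norm_eulerApprox_sub_eulerApprox_le ht x y n)

theorem IsMAccretive.norm_semigroup_sub_semigroup_le_of_mem (hA : IsMAccretive A)
    (hd : Dense (domain A)) {t s : ℝ} (ht : 0 ≤ t) (hs : 0 ≤ s) {x y : X} (hx : (x, y) ∈ A) :
    ‖semigroup A t x - semigroup A s x‖ ≤ |t - s| * ‖y‖ := by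
  have hlim : Tendsto (fun n : ℕ => √((t - s) ^ 2 + t ^ 2 / n + s ^ 2 / n) * ‖y‖) atTop
      (𝓝 (|t - s| * ‖y‖)) := by
    have h := ((tendsto_const_div_atTop_nhds_zero_nat (t ^ 2)).const_add ((t - s) ^ 2)).add
      (tendsto_const_div_atTop_nhds_zero_nat (s ^ 2))
    simpa [Real.sqrt_sq_eq_abs] using h.sqrt.mul_const ‖y‖
  refine le_of_tendsto_of_tendsto
    ((hA.tendsto_eulerApprox hd ht x).sub (hA.tendsto_eulerApprox hd hs x)).norm hlim ?_
  filter_upwards [eventually_ne_atTop 0] with n hn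
  exact hA.norm_eulerApprox_sub_eulerApprox_le_sqrt ht hs hx hn hn

/-- Joint continuity of `(t, x) ↦ S(t⁺) x`. -/
theorem IsMAccretive.continuous_semigroup (hA : IsMAccretive A) (hd : Dense (domain A)) :
    Continuous fun p : ℝ × X => semigroup A (max p.1 0) p.2 := by
  refine continuous_iff_continuousAt.2 fun p => Metric.continuousAt_iff'.2 fun e he => ?_
  obtain ⟨_, hxz, ⟨z, y⟩, hz, rfl⟩ := Metric.dense_iff.1 hd p.2 (e / 3) (by positivity)
  rw [Metric.mem_ball, dist_comm] at hxz
  simp only at hxz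
  have c1 : ContinuousAt (fun q : ℝ × X => dist q.2 z) p := by fun_prop
  have c2 : ContinuousAt (fun q : ℝ × X => |max q.1 0 - max p.1 0| * ‖y‖) p := by fun_prop
  filter_upwards [c1.eventually_lt_const hxz,
    c2.eventually_lt_const (u := e / 3) (by simpa using by positivity)] with q h1 h2
  have e1 := hA.norm_semigroup_sub_semigroup_le hd (le_max_right q.1 0) q.2 z
  have e2 := hA.norm_semigroup_sub_semigroup_le hd (le_max_right p.1 0) z p.2
  have e3 := hA.norm_semigroup_sub_semigroup_le_of_mem hd (le_max_right q.1 0)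
    (le_max_right p.1 0) hz
  simp only [← dist_eq_norm] at e1 e2 e3
  rw [dist_comm] at hxz
  have h4 := dist_triangle4 (semigroup A (max q.1 0) q.2) (semigroup A (max q.1 0) z)
    (semigroup A (max p.1 0) z) (semigroup A (max p.1 0) p.2)
  linarith

end Semigroup

/-! ### Measurability of superpositions -/

section Superposition

variable {α Y Z : Type*} [MeasurableSpace α] [TopologicalSpace Z]
  [TopologicalSpace.PseudoMetrizableSpace Z]

theorem aestronglyMeasurable_comp_simpleFunc {μ : Measure α} {f : α → Y → Z}
    (hf : ∀ y, AEStronglyMeasurable (fun s => f s y) μ) (g : SimpleFunc α Y) :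
    AEStronglyMeasurable (fun s => f s (g s)) μ := by
  have h : ∀ y : g.range, AEStronglyMeasurable (fun s => f s (g s)) (μ.restrict (g ⁻¹' {y.1})) :=
    fun y => (hf y).restrict.congr <| by
      filter_upwards [ae_restrict_mem (g.measurableSet_fiber y.1)] with s hs
      rw [show g s = y.1 from hs]
  have h2 := (aestronglyMeasurable_iUnion_iff (μ := μ)).2 h
  have h3 : ⋃ y : g.range, g ⁻¹' {y.1} = Set.univ :=
    Set.eq_univ_of_forall fun s => Set.mem_iUnion.2 ⟨⟨g s, g.mem_range_self s⟩, rfl⟩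
  rwa [h3, Measure.restrict_univ] at h2

/-- Superposition with a Carathéodory function preserves measurability. -/
theorem aestronglyMeasurable_superposition [TopologicalSpace Y] {μ : Measure α} {f : α → Y → Z}
    (hf : ∀ y, AEStronglyMeasurable (fun s => f s y) μ) (hc : ∀ᵐ s ∂μ, Continuous (f s))
    {g : α → Y} (hg : StronglyMeasurable g) : AEStronglyMeasurable (fun s => f s (g s)) μ := by
  refine aestronglyMeasurable_of_tendsto_ae atTop
    (fun n => aestronglyMeasurable_comp_simpleFunc hf (hg.approx n)) ?_
  filter_upwards [hc] with s hs
  exact (hs.tendsto _).comp (hg.tendsto_approx s)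

end Superposition

/-! ### Nonlinear convolutions -/

section Convolution

variable {X : Type*} [NormedAddCommGroup X] {Φ : ℝ × X → X} {f : ℝ → X}

theorem aestronglyMeasurable_comp_sub (hΦ : Continuous Φ) (hf : AEStronglyMeasurable f volume)
    (t : ℝ) : AEStronglyMeasurable (fun s => Φ (t - s, f s)) volume :=
  hΦ.comp_aestronglyMeasurable
    ((by fun_prop : Continuous fun s : ℝ => t - s).aestronglyMeasurable.prodMk hf)

theorem exists_norm_le_of_lipschitz (hΦ : Continuous Φ)
    (hL : ∀ t x y, ‖Φ (t, x) - Φ (t, y)‖ ≤ ‖x - y‖) (R : ℝ) :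
    ∃ C, ∀ t, |t| ≤ R → ∀ x, ‖Φ (t, x)‖ ≤ ‖x‖ + C := by
  have h0 : Continuous fun t => Φ (t, 0) := by fun_prop
  obtain ⟨C, hC⟩ := (isCompact_Icc (a := -R) (b := R)).exists_bound_of_continuousOn h0.continuousOn
  refine ⟨C, fun t ht x => ?_⟩
  have h1 := hL t x 0
  have h2 := hC t (abs_le.1 ht)
  have h3 := norm_sub_norm_le (Φ (t, x)) (Φ (t, 0))
  rw [sub_zero] at h1
  linarith

theorem intervalIntegrable_comp_sub (hΦ : Continuous Φ)
    (hL : ∀ t x y, ‖Φ (t, x) - Φ (t, y)‖ ≤ ‖x - y‖) (hf : Integrable f) (t a b : ℝ) :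
    IntervalIntegrable (fun s => Φ (t - s, f s)) volume a b := by
  obtain ⟨C, hC⟩ := exists_norm_le_of_lipschitz hΦ hL (|t| + |a| + |b|)
  have hi : IntervalIntegrable (fun s => ‖f s‖ + C) volume a b :=
    hf.norm.intervalIntegrable.add intervalIntegrable_const
  refine hi.mono_fun (aestronglyMeasurable_comp_sub hΦ hf.1 t).restrict ?_
  filter_upwards [ae_restrict_mem measurableSet_uIoc] with s hs
  refine (hC _ ?_ _).trans (le_abs_self _)
  have h1 := abs_sub t s
  have h2 : |s| ≤ |a| + |b| := by rcases Set.mem_uIoc.1 hs with h | h <;> grind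
  linarith

/-- The nonlinear convolution `t ↦ ∫₀ᵗ Φ(t - s, f(s)) ds` is continuous. -/
theorem continuous_integral_comp_sub [NormedSpace ℝ X] (hΦ : Continuous Φ)
    (hL : ∀ t x y, ‖Φ (t, x) - Φ (t, y)‖ ≤ ‖x - y‖) (hf : Integrable f) :
    Continuous fun t : ℝ => ∫ s in (0 : ℝ)..t, Φ (t - s, f s) := by
  refine continuous_iff_continuousAt.2 fun t => ?_
  set b := |t| + 1
  obtain ⟨C, hC⟩ := exists_norm_le_of_lipschitz hΦ hL (2 * b)
  have hb : -b < b := by have := abs_nonneg t; simp only [b]; linarith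
  -- The two roles of `t`, as parameter and as endpoint, are separated; the claim is then read off
  -- on the diagonal.
  have key : ContinuousAt (fun p : ℝ × ℝ => ∫ s in (0 : ℝ)..p.2, Φ (p.1 - s, f s)) (t, t) := by
    refine intervalIntegral.continuousAt_parametric_primitive_of_dominated
      (F := fun r s => Φ (r - s, f s)) (μ := volume)
      (fun s => ‖f s‖ + C) (-b) b
      (fun r => (aestronglyMeasurable_comp_sub hΦ hf.1 r).restrict) ?_
      (hf.norm.intervalIntegrable.add intervalIntegrable_const)
      (Eventually.of_forall fun s => by fun_prop) ⟨by linarith, by linarith⟩ ?_ (by simp)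
    · have : Set.Ioo (-b) b ∈ 𝓝 t := Ioo_mem_nhds (by grind) (by grind)
      filter_upwards [this] with r hr
      filter_upwards [ae_restrict_mem measurableSet_uIoc] with s hs
      rw [Set.uIoc_of_le hb.le] at hs
      exact hC _ (by grind) _
    · exact ⟨by grind, by grind⟩
  exact key.comp (f := fun t : ℝ => (t, t)) (by fun_prop)

end Convolution

/-! ### Running supremum norms -/

section NormUpTo

variable {X : Type*} [NormedAddCommGroup X] {T : ℝ}

theorem normUpTo_nonneg (t : ℝ) (w : C(Set.Icc (0 : ℝ) T, X)) : 0 ≤ normUpTo t w :=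
  Real.iSup_nonneg fun _ => norm_nonneg _

theorem norm_le_normUpTo (w : C(Set.Icc (0 : ℝ) T, X)) {t : ℝ} (s : Set.Icc (0 : ℝ) T)
    (hs : (s : ℝ) ≤ t) : ‖w s‖ ≤ normUpTo t w :=
  le_ciSup (f := fun s : {s : Set.Icc (0 : ℝ) T // (s : ℝ) ≤ t} => ‖w s.1‖)
    ⟨‖w‖, by rintro _ ⟨s, rfl⟩; exact w.norm_coe_le_norm _⟩ ⟨s, hs⟩

theorem normUpTo_le_norm (t : ℝ) (w : C(Set.Icc (0 : ℝ) T, X)) : normUpTo t w ≤ ‖w‖ :=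
  Real.iSup_le (fun s => w.norm_coe_le_norm s.1) (norm_nonneg _)

/-- Holds on all of `ℝ`, since for `t < 0` the supremum is over the empty set and equals `0`.
Monotonicity supplies the measurability of `s ↦ K s (normUpTo s w)`. -/
theorem monotone_normUpTo (w : C(Set.Icc (0 : ℝ) T, X)) : Monotone fun t => normUpTo t w :=
  fun _ _ hab => Real.iSup_le (fun s => norm_le_normUpTo w s.1 (s.2.trans hab))
    (normUpTo_nonneg _ w)

end NormUpTo

/-! ### Consequences of the structural condition -/

section Structural

variable {X : Type*} [NormedAddCommGroup X] {T : ℝ} {F : ℝ → X → X}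
  {K : ℝ → ℝ → ℝ}

theorem StructuralCondition.integrableOn (hK : StructuralCondition T F K) {U : ℝ} (hU : 0 ≤ U) :
    IntegrableOn (fun t => K t U) (Set.Ioo 0 T) :=
  ((hK.locallyIntegrable U hU).integrableOn_isCompact isCompact_Icc).mono_set
    Set.Ioo_subset_Icc_self

theorem StructuralCondition.integrableOn_superposition (hK : StructuralCondition T F K)
    {g : ℝ → ℝ} (hg : StronglyMeasurable g) (h0 : ∀ s, 0 ≤ g s) {M : ℝ} (hM : ∀ s, g s ≤ M) :
    IntegrableOn (fun s => K s (g s)) (Set.Ioo 0 T) := by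
  have hM0 : 0 ≤ M := (h0 0).trans (hM 0)
  refine (hK.integrableOn hM0).mono' ?_ ?_
  · have h := aestronglyMeasurable_superposition (μ := volume.restrict (Set.Ioo 0 T))
      -- `K s` is controlled only on `[0, ∞)`; clamping gives a Carathéodory function on all of `ℝ`.
      (f := fun s y => K s (max y 0)) (fun y => (hK.integrableOn (le_max_right y 0)).1) ?_ hg
    · simpa only [max_eq_left (h0 _)] using h
    · filter_upwards [hK.continuousOn] with s hs
      exact hs.comp_continuous (by fun_prop) fun y => le_max_right y 0
  · filter_upwards [hK.monotoneOn, ae_restrict_mem measurableSet_Ioo] with s hs hsT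
    rw [Real.norm_of_nonneg (hK.nonneg s (Set.Ioo_subset_Icc_self hsT) _ (h0 s))]
    exact hs (h0 s) hM0 (hM s)

theorem StructuralCondition.ae_continuous (hK : StructuralCondition T F K) :
    ∀ᵐ s ∂volume.restrict (Set.Ioo 0 T), Continuous (F s) := by
  filter_upwards [hK.continuousOn, hK.bound, ae_restrict_mem measurableSet_Ioo] with s hc hb hs
  refine continuous_iff_continuousAt.2 fun x => tendsto_iff_norm_sub_tendsto_zero.2 ?_
  have h : Tendsto (fun y => K s ‖y - x‖) (𝓝 x) (𝓝 0) := by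
    have hk : Continuous fun U => K s |U| :=
      hc.comp_continuous (by fun_prop) fun y => abs_nonneg y
    have h1 : Continuous fun y => K s |‖y - x‖| := hk.comp (by fun_prop)
    simpa [hK.zero s (Set.Ioo_subset_Icc_self hs)] using h1.tendsto x
  exact squeeze_zero (fun _ => norm_nonneg _) (fun y => hb y x) h

theorem StructuralCondition.integrableOn_comp (hK : StructuralCondition T F K)
    (hF : ∀ x : X, IntegrableOn (fun s => F s x) (Set.Icc 0 T)) {g : ℝ → X}
    (hg : StronglyMeasurable g) {M : ℝ} (hM : ∀ s, ‖g s‖ ≤ M) :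
    IntegrableOn (fun s => F s (g s)) (Set.Ioo 0 T) := by
  have hF' := fun x => (hF x).mono_set Set.Ioo_subset_Icc_self
  have hi : IntegrableOn (fun s => ‖F s 0‖ + K s ‖g s‖) (Set.Ioo 0 T) :=
    (hF' 0).norm.add (hK.integrableOn_superposition hg.norm (fun _ => norm_nonneg _) hM)
  refine hi.mono' (aestronglyMeasurable_superposition (fun x => (hF' x).1) hK.ae_continuous hg) ?_
  filter_upwards [hK.bound] with s hs
  have h1 := hs (g s) 0
  have h2 := norm_sub_norm_le (F s (g s)) (F s 0)
  rw [sub_zero] at h1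
  linarith

/-- Dominated convergence with majorant `K(·, 1)`, using `K(s, 0) = 0`. -/
theorem StructuralCondition.tendsto_integral_zero (hK : StructuralCondition T F K) :
    Tendsto (fun U => ∫ s in Set.Ioo 0 T, K s |U|) (𝓝 0) (𝓝 0) := by
  have h : Tendsto (fun U => ∫ s in Set.Ioo 0 T, K s |U|) (𝓝 0)
      (𝓝 (∫ _ in Set.Ioo 0 T, (0 : ℝ))) := by
    refine tendsto_integral_filter_of_dominated_convergence (fun s => K s 1)
      (Eventually.of_forall fun U => (hK.integrableOn (abs_nonneg U)).1) ?_
      (hK.integrableOn zero_le_one) ?_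
    · have : ∀ᶠ U : ℝ in 𝓝 0, |U| < 1 :=
        (continuous_abs.tendsto' (0 : ℝ) 0 abs_zero).eventually_lt_const one_pos
      filter_upwards [this] with U hU
      filter_upwards [hK.monotoneOn, ae_restrict_mem measurableSet_Ioo] with s hs hsT
      rw [Real.norm_of_nonneg (hK.nonneg s (Set.Ioo_subset_Icc_self hsT) _ (abs_nonneg U))]
      exact hs (abs_nonneg U) (Set.mem_Ici.2 zero_le_one) hU.le
    · filter_upwards [hK.continuousOn, ae_restrict_mem measurableSet_Ioo] with s hc hs
      have hk : Continuous fun U => K s |U| :=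
        hc.comp_continuous (by fun_prop) fun y => abs_nonneg y
      simpa [hK.zero s (Set.Ioo_subset_Icc_self hs)] using hk.tendsto 0
  simpa using h

theorem StructuralCondition.integrable_indicator (hK : StructuralCondition T F K) (hT : 0 ≤ T)
    (hF : ∀ x : X, IntegrableOn (fun s => F s x) (Set.Icc 0 T)) (u : C(Set.Icc (0 : ℝ) T, X)) :
    Integrable ((Set.Ioo 0 T).indicator fun s => F s (Set.IccExtend hT u s)) :=
  (integrable_indicator_iff measurableSet_Ioo).2 <|
    hK.integrableOn_comp hF (u.continuous.Icc_extend' (h := hT)).stronglyMeasurable (M := ‖u‖)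
      fun s => u.norm_coe_le_norm (Set.projIcc 0 T hT s)

theorem StructuralCondition.intervalIntegrable_normUpTo (hK : StructuralCondition T F K)
    (w : C(Set.Icc (0 : ℝ) T, X)) {t : ℝ} (ht : t ∈ Set.Icc 0 T) :
    IntervalIntegrable (fun s => K s (normUpTo s w)) volume 0 t := by
  have h := hK.integrableOn_superposition
    (monotone_normUpTo w).measurable.stronglyMeasurable (fun s => normUpTo_nonneg s w)
    (fun s => normUpTo_le_norm s w)
  rw [intervalIntegrable_iff_integrableOn_Ioo_of_le ht.1]
  exact h.mono_set (Set.Ioo_subset_Ioo_right ht.2)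

theorem StructuralCondition.integral_normUpTo_mono (hK : StructuralCondition T F K)
    (w : C(Set.Icc (0 : ℝ) T, X)) {s t : ℝ} (hs : 0 ≤ s) (hst : s ≤ t) (ht : t ≤ T) :
    ∫ r in (0 : ℝ)..s, K r (normUpTo r w) ≤ ∫ r in (0 : ℝ)..t, K r (normUpTo r w) := by
  refine intervalIntegral.integral_mono_interval le_rfl hs hst ?_
    (hK.intervalIntegrable_normUpTo w ⟨hs.trans hst, ht⟩)
  filter_upwards [ae_restrict_mem measurableSet_Ioc] with r hr
  exact hK.nonneg r ⟨hr.1.le, hr.2.trans ht⟩ _ (normUpTo_nonneg _ _)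

theorem StructuralCondition.integral_normUpTo_le (hK : StructuralCondition T F K)
    (w : C(Set.Icc (0 : ℝ) T, X)) (hT : 0 ≤ T) :
    ∫ r in (0 : ℝ)..T, K r (normUpTo r w) ≤ ∫ r in Set.Ioo 0 T, K r |‖w‖| := by
  rw [intervalIntegral.integral_of_le hT, integral_Ioc_eq_integral_Ioo, abs_norm]
  refine integral_mono_ae
    (hK.integrableOn_superposition
      (monotone_normUpTo w).measurable.stronglyMeasurable (fun s => normUpTo_nonneg s w)
      (fun s => normUpTo_le_norm s w)) (hK.integrableOn (norm_nonneg w)) ?_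
  filter_upwards [hK.monotoneOn] with s hs
  exact hs (normUpTo_nonneg s w) (norm_nonneg w) (normUpTo_le_norm s w)

end Structural

/-! ### The Duhamel operator -/

section Duhamel

variable {X : Type*} [NormedAddCommGroup X] [NormedSpace ℝ X]
  {A : Set (X × X)} {T : ℝ} {F : ℝ → X → X} {K : ℝ → ℝ → ℝ}

theorem ae_eq_indicator_of_mem_uIoc {E : Type*} [Zero E] {t : ℝ} (ht : t ∈ Set.Icc 0 T)
    (g : ℝ → E) :
    ∀ᵐ s, s ∈ Set.uIoc 0 t → s ≤ t ∧ s ∈ Set.Ioo 0 T ∧ (Set.Ioo 0 T).indicator g s = g s := by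
  have h : ∀ᵐ s : ℝ, s ≠ T := by simp [ae_iff]
  filter_upwards [h] with s hs hst
  rw [Set.uIoc_of_le ht.1] at hst
  have hm : s ∈ Set.Ioo 0 T := ⟨hst.1, lt_of_le_of_ne (hst.2.trans ht.2) hs⟩
  exact ⟨hst.2, hm, Set.indicator_of_mem hm g⟩

/-- Clamping time at `0` and extending the source by zero put the formula in the form of the
convolution lemmas, which need globally defined data. -/
theorem duhamel_eq {t : ℝ} (ht : t ∈ Set.Icc 0 T) (u₀ : X) (u : ℝ → X) :
    duhamel A F u₀ u t = semigroup A (max t 0) u₀ + ∫ s in (0 : ℝ)..t,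
      semigroup A (max (t - s) 0) ((Set.Ioo 0 T).indicator (fun s => F s (u s)) s) := by
  unfold duhamel
  rw [max_eq_left ht.1]
  congr 1
  refine intervalIntegral.integral_congr_ae ?_
  filter_upwards [ae_eq_indicator_of_mem_uIoc ht fun s => F s (u s)] with s hs hst
  obtain ⟨h1, -, h2⟩ := hs hst
  rw [h2, max_eq_left (sub_nonneg.2 h1)]

variable [CompleteSpace X]

theorem StructuralCondition.intervalIntegrable_semigroup (hK : StructuralCondition T F K)
    (hA : IsMAccretive A) (hd : Dense (domain A)) (hT : 0 ≤ T)
    (hF : ∀ x : X, IntegrableOn (fun s => F s x) (Set.Icc 0 T)) (u : C(Set.Icc (0 : ℝ) T, X))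
    {t : ℝ} (ht : t ∈ Set.Icc 0 T) :
    IntervalIntegrable (fun s => semigroup A (t - s) (F s (Set.IccExtend hT u s))) volume 0 t := by
  refine (intervalIntegrable_comp_sub
    (Φ := fun p => semigroup A (max p.1 0) p.2) (hA.continuous_semigroup hd)
    (fun t x y => hA.norm_semigroup_sub_semigroup_le hd (t := max t 0) (le_max_right t 0) x y)
    (hK.integrable_indicator hT hF u) t 0 t).congr_ae ?_
  refine (ae_restrict_iff' measurableSet_uIoc).2 ?_
  filter_upwards [ae_eq_indicator_of_mem_uIoc ht fun s => F s (Set.IccExtend hT u s)] with s hs hst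
  obtain ⟨h1, -, h2⟩ := hs hst
  simp only [h2, max_eq_left (sub_nonneg.2 h1)]

theorem StructuralCondition.continuousOn_duhamel (hK : StructuralCondition T F K)
    (hA : IsMAccretive A) (hd : Dense (domain A)) (hT : 0 ≤ T)
    (hF : ∀ x : X, IntegrableOn (fun s => F s x) (Set.Icc 0 T)) (u₀ : X)
    (u : C(Set.Icc (0 : ℝ) T, X)) :
    ContinuousOn (duhamel A F u₀ (Set.IccExtend hT u)) (Set.Icc 0 T) := by
  have h1 : Continuous fun t => semigroup A (max t 0) u₀ :=
    (hA.continuous_semigroup hd).comp (f := fun t : ℝ => (t, u₀)) (by fun_prop)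
  have h2 := continuous_integral_comp_sub
    (Φ := fun p => semigroup A (max p.1 0) p.2) (hA.continuous_semigroup hd)
    (fun t x y => hA.norm_semigroup_sub_semigroup_le hd (t := max t 0) (le_max_right t 0) x y)
    (hK.integrable_indicator hT hF u)
  exact (h1.add h2).continuousOn.congr fun t ht => duhamel_eq ht _ _

theorem StructuralCondition.norm_duhamel_sub_duhamel_le (hK : StructuralCondition T F K)
    (hA : IsMAccretive A) (hd : Dense (domain A)) (hT : 0 ≤ T)
    (hF : ∀ x : X, IntegrableOn (fun s => F s x) (Set.Icc 0 T)) (u₀ v₀ : X)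
    (u v : C(Set.Icc (0 : ℝ) T, X)) {t : ℝ} (ht : t ∈ Set.Icc 0 T) :
    ‖duhamel A F u₀ (Set.IccExtend hT u) t - duhamel A F v₀ (Set.IccExtend hT v) t‖ ≤
      ‖u₀ - v₀‖ + ∫ s in (0 : ℝ)..t, K s (normUpTo s (u - v)) := by
  unfold duhamel
  rw [add_sub_add_comm, ← intervalIntegral.integral_sub
    (hK.intervalIntegrable_semigroup hA hd hT hF u ht)
    (hK.intervalIntegrable_semigroup hA hd hT hF v ht)]
  refine (norm_add_le _ _).trans (add_le_add (hA.norm_semigroup_sub_semigroup_le hd ht.1 _ _) ?_)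
  refine intervalIntegral.norm_integral_le_of_norm_le ht.1 ?_
    (hK.intervalIntegrable_normUpTo (u - v) ht)
  filter_upwards [(ae_restrict_iff' measurableSet_Ioo).1 hK.bound,
    (ae_restrict_iff' measurableSet_Ioo).1 hK.monotoneOn,
    ae_eq_indicator_of_mem_uIoc ht fun s => s] with s hb hm hs hst
  rw [← Set.uIoc_of_le ht.1] at hst
  obtain ⟨h1, h2, -⟩ := hs hst
  refine (hA.norm_semigroup_sub_semigroup_le hd (sub_nonneg.2 h1) _ _).trans
    ((hb h2 _ _).trans (hm h2 (norm_nonneg _) (normUpTo_nonneg _ _) ?_))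
  have hs' := Set.Ioo_subset_Icc_self h2
  rw [Set.IccExtend_of_mem _ _ hs', Set.IccExtend_of_mem _ _ hs']
  exact norm_le_normUpTo (u - v) ⟨s, hs'⟩ le_rfl

end Duhamel

end MildEvolution

theorem proposition3p1 {X : Type*} [NormedAddCommGroup X] [NormedSpace ℝ X] [CompleteSpace X]
    (A : Set (X × X)) (hA : MildEvolution.IsMAccretive A)
    (hdense : Dense (MildEvolution.domain A))
    (T : ℝ) (hT : 0 < T)
    (F : ℝ → X → X) (hF : ∀ x : X, IntegrableOn (fun s => F s x) (Set.Icc 0 T))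
    (K : ℝ → ℝ → ℝ) (hK : MildEvolution.StructuralCondition T F K) :
    -- the limit defining the semigroup exists
    (∀ t : ℝ, 0 ≤ t → ∀ x : X,
      Tendsto (MildEvolution.eulerApprox A t x) atTop (𝓝 (MildEvolution.semigroup A t x))) ∧
    -- the Bochner integral defining the operator exists
    (∀ u : C(Set.Icc (0 : ℝ) T, X), ∀ t ∈ Set.Icc 0 T,
      IntervalIntegrable
        (fun s => MildEvolution.semigroup A (t - s) (F s (Set.IccExtend hT.le u s)))
        volume 0 t) ∧
    -- the operator maps `C([0,T]; X)` into itself, with the estimate, and is continuous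
    ∃ G : X → C(Set.Icc (0 : ℝ) T, X) → C(Set.Icc (0 : ℝ) T, X),
      (∀ (u₀ : X) (u : C(Set.Icc (0 : ℝ) T, X)) (t : Set.Icc (0 : ℝ) T),
        G u₀ u t = MildEvolution.duhamel A F u₀ (Set.IccExtend hT.le u) t) ∧
      (∀ (u₀ v₀ : X) (u v : C(Set.Icc (0 : ℝ) T, X)), ∀ t ∈ Set.Icc 0 T,
        IntervalIntegrable (fun s => K s (MildEvolution.normUpTo s (u - v))) volume 0 t ∧
        MildEvolution.normUpTo t (G u₀ u - G v₀ v) ≤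
          ‖u₀ - v₀‖ + ∫ s in (0 : ℝ)..t, K s (MildEvolution.normUpTo s (u - v))) ∧
      (∀ u₀ : X, Continuous (G u₀)) := by
  have hestimate := hK.norm_duhamel_sub_duhamel_le hA hdense hT.le hF
  refine ⟨fun t ht x => hA.tendsto_eulerApprox hdense ht x,
    fun u t ht => hK.intervalIntegrable_semigroup hA hdense hT.le hF u ht,
    fun u₀ u => ⟨_, (hK.continuousOn_duhamel hA hdense hT.le hF u₀ u).domRestrict⟩,
    fun _ _ _ => rfl, fun u₀ v₀ u v t ht => ⟨hK.intervalIntegrable_normUpTo (u - v) ht, ?_⟩,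
    fun u₀ => continuous_iff_continuousAt.2 fun u => ?_⟩
  · have h0 := hK.integral_normUpTo_mono (u - v) le_rfl ht.1 ht.2
    rw [intervalIntegral.integral_same] at h0
    -- The pointwise bound at `s ≤ t` is enlarged to the one at `t`, as `K ≥ 0`.
    refine Real.iSup_le (fun s => (hestimate u₀ v₀ u v s.1.2).trans ?_) (by positivity)
    gcongr
    exact hK.integral_normUpTo_mono (u - v) s.1.2.1 s.2 ht.2
  · refine tendsto_iff_norm_sub_tendsto_zero.2 ?_
    have h1 : Tendsto (fun v : C(Set.Icc (0 : ℝ) T, X) => ‖v - u‖) (𝓝 u) (𝓝 0) :=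
      tendsto_iff_norm_sub_tendsto_zero.1 tendsto_id
    refine squeeze_zero (fun _ => norm_nonneg _) (fun v => ?_) (hK.tendsto_integral_zero.comp h1)
    have h2 := hK.integral_normUpTo_le (v - u) hT.le
    have h0 := hK.integral_normUpTo_mono (v - u) le_rfl hT.le le_rfl
    rw [intervalIntegral.integral_same] at h0
    refine (ContinuousMap.norm_le _ (h0.trans h2)).2 fun t => ?_
    have h3 := hestimate u₀ u₀ v u t.2
    rw [sub_self, norm_zero, zero_add] at h3
    exact (h3.trans (hK.integral_normUpTo_mono (v - u) t.2.1 t.2.2 le_rfl)).trans h2
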